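/- **Proposition (Hamiltonization of the 3-dimensional Chaplygin ball).** Let $S=\mathrm{SO}(3)$, and let $\langle X,Y\rangle=-\tfrac12\operatorname{tr}(XY)$ on $\mathfrak{so}(3)$. Trivialize $TS=S\times\mathfrak{so}(3)$ by left translation, so that $(s,u)$ stands for the tangent vector $su\in T_sS$. Let $e_1,e_2,e_3$ be the standard basis of $\mathbb R^3$, let $H=\{h\in S: he_3=e_3\}$ with Lie algebra $\mathfrak h\cong\mathbb R$, acting on $S$ by left multiplication, and let $Z_1,Z_2$ and $Y_3$ be the orthonormal bases of $\mathfrak h^\perp$ and $\mathfrak h$ given by $Z_a=E_{a3}-E_{3a}$ and $Y_3=E_{12}-E_{21}$. Let $\mathbb I:\mathfrak{so}(3)\to\mathfrak{so}(3)$ (the inertia tensor of the possibly inhomogeneous ball of mass and radius $1$) be any linear map that is symmetric and positive definite with respect to $\langle\cdot,\cdot\rangle$. The rolling constraint is given by $$\mathcal A_s(u)=-\sum_{a=1}^{2}\langle e_a,(\mathrm{Ad}(s)u)e_3\rangle e_a=-\sum_{a=1}^2\langle Z_a,\mathrm{Ad}(s)u\rangle e_a\in\mathbb R^2 .$$ Put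 $\Phi_s=\mathbb I+\mathcal A_s^*\mathcal A_s$, let $\mu_0$ be the Riemannian metric $(\mu_0)_s(u,v)=\langle\Phi_su,v\rangle$ on $S$, and let $$f(s)=(\det\Phi_s)^{-1/2}.$$ Let $\theta^S$ be the canonical one-form of $T^*S$ transported to $TS$ by $\mu_0$, i.e. $\theta^S_{(s,u)}(\delta s,\delta u)=(\mu_0)_s(u,s^{-1}\delta s)$, and $\Omega^S=-d\theta^S$. Let $J_H:TS\to\mathfrak h^*$, $\langle J_H(s,u),Y\rangle=(\mu_0)_s(u,\mathrm{Ad}(s^{-1})Y)$, be the standard momentum map of the lifted $H$-action. Let $\omega_s(\delta s)=\langle Y_3,\delta s\,s^{-1}\rangle Y_3$ be the standard connection form of $S\to S/H$, let $\mathrm{Curv}^\omega=d\omega-\tfrac12[\omega,\omega]$ be its curvature, let $L(s,u)=\langle Y_3,\mathrm{Ad}(s)u\rangle Y_3$, and define the truncated two-form on $TS$ by $$\widetilde\Omega=\Omega^S-\langle L,\mathrm{Curv}^\omega\rangle .$$ Then for every $\lambda\in\mathfrak h^*\cong\mathbb R$ the restriction of the two-form $f\,\widetilde\Omega$ to the level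 set $J_H^{-1}(\lambda)\subset TS$ is closed: $d(f\widetilde\Omega)|_{J_H^{-1}(\lambda)}=0$. -/

import Mathlib

open scoped Matrix ContDiff

attribute [local instance] Matrix.normedAddCommGroup Matrix.normedSpace

namespace ChaplyginBall

noncomputable section

/-! ### Differential forms on submanifolds of a normed space

A differential form on an embedded submanifold `M` of a normed space `E` is given by a form `α`
on (an open subset of) `E`; only the pullback of `α` to `M` matters. -/

/-- The pullback `φ^* α` of a differential form along a map. -/
def pullback {F E G : Type*} [NormedAddCommGroup F] [NormedSpace ℝ F]
    [NormedAddCommGroup E] [NormedSpace ℝ E] [NormedAddCommGroup G] [NormedSpace ℝ G] {k : ℕ}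
    (φ : F → E) (α : E → E [⋀^Fin k]→L[ℝ] G) (x : F) : F [⋀^Fin k]→L[ℝ] G :=
  (α (φ x)).compContinuousLinearMap (fderiv ℝ φ x)

/-- The pullback of the form `α` to `M` is closed: `d (φ^* α) = 0` for every smooth map `φ` from an
open subset `U` of some `ℝ^m` into `E` with values in `M`. If `M` is an embedded submanifold, these
`φ` are exactly the smooth maps `U → M`; the local parametrizations of `M` are among them, so this
is closedness on `M` of the restriction of `α` to `M`. -/
def IsClosedOn {E : Type*} [NormedAddCommGroup E] [NormedSpace ℝ E] {k : ℕ}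
    (M : Set E) (α : E → E [⋀^Fin k]→L[ℝ] ℝ) : Prop :=
  ∀ (m : ℕ) (U : Set (EuclideanSpace ℝ (Fin m))) (φ : EuclideanSpace ℝ (Fin m) → E),
    IsOpen U → ContDiffOn ℝ ∞ φ U → Set.MapsTo φ U M →
      ∀ x ∈ U, extDeriv (pullback φ α) x = 0

/-! ### The Lie algebra `𝔰𝔬(3)` -/

/-- Real `3 × 3` matrices. -/
abbrev Mat : Type := Matrix (Fin 3) (Fin 3) ℝ

/-- `𝔰𝔬(3)`, the skew-symmetric matrices. -/
def so3 : Submodule ℝ Mat where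
  carrier := {A | Aᵀ = -A}
  add_mem' {A B} hA hB := by
    change (A + B)ᵀ = -(A + B)
    rw [Matrix.transpose_add, show Aᵀ = -A from hA, show Bᵀ = -B from hB, neg_add]
  zero_mem' := by
    change (0 : Mat)ᵀ = -0
    simp
  smul_mem' c A hA := by
    change (c • A)ᵀ = -(c • A)
    rw [Matrix.transpose_smul, show Aᵀ = -A from hA, smul_neg]

theorem mem_so3 {A : Mat} : A ∈ so3 ↔ Aᵀ = -A := Iff.rfl

/-- The bilinear form `⟨X, Y⟩ = - 1/2 tr (X Y)`; on `𝔰𝔬(3)` it is the normalized `Ad`-invariant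
inner product. -/
def pairing : Mat →ₗ[ℝ] Mat →ₗ[ℝ] ℝ :=
  LinearMap.mk₂ ℝ (fun X Y => -(1 / 2 : ℝ) * (X * Y).trace)
    (fun X X' Y => by simp only [add_mul, Matrix.trace_add]; ring)
    (fun c X Y => by simp only [smul_mul_assoc, Matrix.trace_smul, smul_eq_mul]; ring)
    (fun X Y Y' => by simp only [mul_add, Matrix.trace_add])
    (fun c X Y => by simp only [mul_smul_comm, Matrix.trace_smul, smul_eq_mul]; ring)

/-- `Ad(s) u = s u s⁻¹`, where `s⁻¹ = sᵀ` for `s ∈ SO(3)`. Written with the transpose it makes sense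
for all matrices `s`. In particular `Ad(s⁻¹)` is `Ad sᵀ`. -/
def Ad (s : Mat) : so3 →ₗ[ℝ] so3 where
  toFun u := ⟨s * (u : Mat) * sᵀ, by
    have h : ((u : Mat))ᵀ = -(u : Mat) := mem_so3.1 u.2
    refine mem_so3.2 ?_
    simp [Matrix.transpose_mul, h, Matrix.mul_assoc]⟩
  map_add' u v := by ext1; simp [mul_add, add_mul]
  map_smul' c u := by ext1; simp

/-- The elementary skew-symmetric matrix `E_ij - E_ji`. -/
def elem (i j : Fin 3) : so3 :=
  ⟨Matrix.single i j 1 - Matrix.single j i 1, by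
    refine mem_so3.2 ?_
    simp⟩

/-- `Z_1, Z_2`: the orthonormal basis of `𝔥^⊥` with `⟨Z_a, u⟩ = ⟨e_a, u e_3⟩`. -/
def Z (a : Fin 2) : so3 := elem a.castSucc 2

/-- The unit vector `Y_3` spanning `𝔥`. -/
def Y3 : so3 := elem 0 1

/-- The Lie algebra `𝔥 = {Y ∈ 𝔰𝔬(3) : Y e_3 = 0}` of `H = {h ∈ SO(3) : h e_3 = e_3}`. -/
def hLie : Submodule ℝ so3 where
  carrier := {Y | (Y : Mat) *ᵥ Pi.single 2 1 = 0}
  add_mem' {X Y} hX hY := by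
    change ((X : Mat) + (Y : Mat)) *ᵥ Pi.single 2 1 = 0
    rw [Matrix.add_mulVec, show (X : Mat) *ᵥ _ = 0 from hX, show (Y : Mat) *ᵥ _ = 0 from hY,
      add_zero]
  zero_mem' := Matrix.zero_mulVec _
  smul_mem' c X hX := by
    change (c • (X : Mat)) *ᵥ Pi.single 2 1 = 0
    rw [Matrix.smul_mulVec, show (X : Mat) *ᵥ _ = 0 from hX, smul_zero]

/-! ### The ball -/

/-- The inertia tensor of the ball: any positive definite symmetric operator on `𝔰𝔬(3)`. -/
structure IsInertiaTensor (I : so3 →ₗ[ℝ] so3) : Prop where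
  symm : ∀ u v : so3, pairing (I u) v = pairing u (I v)
  pos : ∀ u : so3, u ≠ 0 → 0 < pairing (I u) u

/-- The constraint form `𝒜_s : T_s S = 𝔰𝔬(3) → ℝ²` of rolling without slipping,
`𝒜_s u = - ∑ a, ⟨e_a, (Ad(s) u) e_3⟩ e_a`. -/
def conn (s : Mat) : so3 →ₗ[ℝ] (Fin 2 → ℝ) where
  toFun u a := -(Ad s u : Mat) a.castSucc 2
  map_add' u v := by ext a; simp; ring
  map_smul' c u := by ext a; simp

/-- The adjoint `𝒜_s^* : ℝ² → 𝔰𝔬(3)`, `𝒜_s^* x = - ∑ a, x_a Ad(s⁻¹) Z_a`. -/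
def connAdj (s : Mat) : (Fin 2 → ℝ) →ₗ[ℝ] so3 where
  toFun x := -∑ a, x a • Ad sᵀ (Z a)
  map_add' x y := by simp only [Pi.add_apply, add_smul, Finset.sum_add_distrib, neg_add]
  map_smul' c x := by
    simp only [Pi.smul_apply, smul_eq_mul, mul_smul, ← Finset.smul_sum, RingHom.id_apply, smul_neg]

/-- `𝒜_s^*` is the adjoint of `𝒜_s` for `⟨·,·⟩` and the Euclidean inner product. -/
theorem pairing_connAdj (s : Mat) (x : Fin 2 → ℝ) (u : so3) :
    pairing (connAdj s x) u = x ⬝ᵥ conn s u := by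
  have h : ((u : Mat))ᵀ = -(u : Mat) := mem_so3.1 u.2
  have h' : ∀ i j, (u : Mat) j i = -(u : Mat) i j := fun i j => congrFun (congrFun h i) j
  have h00 := h' 0 0
  have h11 := h' 1 1
  have h22 := h' 2 2
  have h01 := h' 0 1
  have h02 := h' 0 2
  have h12 := h' 1 2
  have k00 : (u : Mat) 0 0 = 0 := by linarith
  have k11 : (u : Mat) 1 1 = 0 := by linarith
  have k22 : (u : Mat) 2 2 = 0 := by linarith
  simp [pairing, connAdj, conn, Ad, Z, elem, dotProduct, Fin.sum_univ_two, Fin.sum_univ_three,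
    Matrix.trace, Matrix.mul_apply, Matrix.single_apply, k00, k11, k22, h01, h02, h12]
  ring

/-- The metric `μ₀` on `S = SO(3)`, in the left trivialization. -/
def mu0 (I : so3 →ₗ[ℝ] so3) (s : Mat) (u v : so3) : ℝ :=
  pairing (I u) v + conn s u ⬝ᵥ conn s v

/-- `Φ_s = 𝕀 + 𝒜_s^* 𝒜_s`. -/
def Phi (I : so3 →ₗ[ℝ] so3) (s : Mat) : so3 →ₗ[ℝ] so3 := I + connAdj s ∘ₗ conn s

/-- `Φ` is the isomorphism `T S → T^* S` given by `μ₀`. -/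
theorem pairing_Phi (I : so3 →ₗ[ℝ] so3) (s : Mat) (u v : so3) :
    pairing (Phi I s u) v = mu0 I s u v := by
  simp [Phi, mu0, pairing_connAdj]

/-- The conformal factor `f(s) = (det Φ_s)^(-1/2)`. -/
def f (I : so3 →ₗ[ℝ] so3) (s : Mat) : ℝ := (LinearMap.det (Phi I s)) ^ (-(1 / 2) : ℝ)

/-! ### Phase space `T S ≅ S × 𝔰𝔬(3)` (left trivialization), `S = SO(3)` -/

/-- The vector space in which `T S` is an embedded submanifold. -/
abbrev Amb : Type := Mat × so3

/-- `T S = SO(3) × 𝔰𝔬(3)`; the pair `(s, u)` is the tangent vector `s u` at `s`. -/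
def TS : Set Amb := {p | p.1 ∈ Matrix.specialOrthogonalGroup (Fin 3) ℝ}

/-- The momentum map `J_H : T S → 𝔥^*` of the lifted action of `H` by left multiplication:
`⟨J_H(s, u), Y⟩ = μ₀(u, ζ_Y(s))` with the infinitesimal generator `ζ_Y(s) = Ad(s⁻¹) Y`. -/
def JH (I : so3 →ₗ[ℝ] so3) (p : Amb) : Module.Dual ℝ hLie where
  toFun Y := mu0 I p.1 p.2 (Ad p.1ᵀ (Y : so3))
  map_add' X Y := by simp [mu0, dotProduct_add]; ring
  map_smul' c X := by simp [mu0]; ring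

/-- The level set `J_H⁻¹(λ)` in `T S`. As `⟨J_H(s, u), Y_3⟩ = ⟨𝕀 u, Ad(s⁻¹) Y_3⟩` has non-zero
derivative in the direction `δu = Ad(s⁻¹) Y_3`, it is an embedded submanifold of dimension `5`. -/
def levelSet (I : so3 →ₗ[ℝ] so3) (lam : Module.Dual ℝ hLie) : Set Amb :=
  {p | p ∈ TS ∧ JH I p = lam}

/-- The canonical one-form of `T^* S`, transported to `T S` by `μ₀`: at `(s, u)` it maps a tangent
vector `(δs, δu)` to `μ₀(u, s⁻¹ δs) = ⟨Φ_s u, s⁻¹ δs⟩`, where `s⁻¹ = sᵀ`. -/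
def theta (I : so3 →ₗ[ℝ] so3) (p : Amb) : Amb [⋀^Fin 1]→L[ℝ] ℝ :=
  ContinuousAlternatingMap.ofSubsingleton ℝ Amb ℝ (0 : Fin 1) <|
    LinearMap.toContinuousLinearMap <|
      pairing (Phi I p.1 p.2) ∘ₗ LinearMap.mulLeft ℝ (p.1ᵀ) ∘ₗ LinearMap.fst ℝ Mat so3

/-- The canonical symplectic form `Ω^S = - d θ`. -/
def OmegaS (I : so3 →ₗ[ℝ] so3) (p : Amb) : Amb [⋀^Fin 2]→L[ℝ] ℝ := -extDeriv (theta I) p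

/-- The standard connection form `ω = ρ³ Y_3` of `S → S / H` (pulled back to `T S`): the orthogonal
projection to `𝔥` of the velocity `δs s⁻¹` in the space frame, where `s⁻¹ = sᵀ`. -/
def omega (p : Amb) : Amb [⋀^Fin 1]→L[ℝ] Mat :=
  ContinuousAlternatingMap.ofSubsingleton ℝ Amb Mat (0 : Fin 1) <|
    LinearMap.toContinuousLinearMap <|
      (pairing Y3 ∘ₗ LinearMap.mulRight ℝ (p.1ᵀ) ∘ₗ LinearMap.fst ℝ Mat so3).smulRight (Y3 : Mat)

/-- For a matrix valued one-form `a`, the two-form `1/2 [a, a] : (v, w) ↦ [a v, a w]`, with the commutator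
of matrices. -/
def halfBracket (a : Amb [⋀^Fin 1]→L[ℝ] Mat) : Amb [⋀^Fin 2]→L[ℝ] Mat where
  toFun v := a ![v 0] * a ![v 1] - a ![v 1] * a ![v 0]
  map_update_add' v i x y := by
    have hadd : ∀ x y : Amb, a ![x + y] = a ![x] + a ![y] := fun x y => by
      have h := a.map_update_add ![x] 0 x y
      have hu : ∀ z : Amb, Function.update ![x] 0 z = ![z] := fun z => by
        ext1 i; fin_cases i; simp
      simpa only [hu] using h
    fin_cases i <;> simp [hadd, add_mul, mul_add] <;> abel
  map_update_smul' v i c x := by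
    have hsmul : ∀ (c : ℝ) (x : Amb), a ![c • x] = c • a ![x] := fun c x => by
      have h := a.map_update_smul ![x] 0 c x
      have hu : ∀ z : Amb, Function.update ![x] 0 z = ![z] := fun z => by
        ext1 i; fin_cases i; simp
      simpa only [hu] using h
    fin_cases i <;> simp [hsmul, smul_sub]
  map_eq_zero_of_eq' v i j hv hij := by
    have h01 : v 0 = v 1 := by
      fin_cases i <;> fin_cases j <;> simp_all
    rw [h01, sub_self]
  cont := by
    have h : ∀ i : Fin 2, Continuous fun v : Fin 2 → Amb => a ![v i] := fun i =>
      a.cont.comp (continuous_pi fun j => by fin_cases j; exact continuous_apply i)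
    exact ((h 0).mul (h 1)).sub ((h 1).mul (h 0))

/-- The exterior derivative `d ω`. -/
def dOmega (p : Amb) : Amb [⋀^Fin 2]→L[ℝ] Mat := extDeriv omega p

/-- The curvature `Curv^ω = d ω - 1/2 [ω, ω]`. -/
def curv (p : Amb) : Amb [⋀^Fin 2]→L[ℝ] Mat := dOmega p - halfBracket (omega p)

/-- `L : T S → 𝔥`, the one-form `ω` viewed as a function on `T S`: `L(s, u) = l_3(s, u) Y_3` with
`l_3(s, u) = ⟨Y_3, Ad(s) u⟩`. -/
def L (p : Amb) : Mat := pairing Y3 (Ad p.1 p.2) • (Y3 : Mat)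

/-- The truncated form `Ω̃ = Ω^S - ⟨L, Curv^ω⟩`. -/
def OmegaTilde (I : so3 →ₗ[ℝ] so3) (p : Amb) : Amb [⋀^Fin 2]→L[ℝ] ℝ :=
  OmegaS I p -
    (LinearMap.toContinuousLinearMap (pairing (L p))).compContinuousAlternatingMap (curv p)

end

end ChaplyginBall

/-! Everything is computed in the space frame `X i` = Ad(s⁻¹)e_i with e = (Z_1, Z_2, Y_3), and with
the one-forms ρ_i = ⟨e_i, δs s⁻¹⟩ (`r`). If w is the coordinate vector of u and J the matrix of 𝕀,
then Φ_s has matrix J + diag(1,1,0). Its determinant is G, so f = G^(-1/2), and m = (J +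
diag(1,1,0))w is the momentum. The component m_2 is the momentum map of H, hence constant on a level
set.

On vectors tangent to TS one has θ = ∑ m_i ρ_i, and ⟨L, Curv⟩ = w_2 dρ_2 because 𝔥 is abelian. So
-Ω̃ restricts to e = dθ + w_2 dρ_2, with de = dw_2 ∧ dρ_2, and closedness of fΩ̃ amounts to dG ∧ e =
2G dw_2 ∧ dρ_2.

Let A be the cofactor matrix of J + 1 and n = (J + 1)w, so n_0 = m_0, n_1 = m_1, n_2 = m_2 + w_2. As
s varies, J is only conjugated by rotations, so det(J + 1) = G + A_22 stays constant and dG = -dA_22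
= 2(A_12 ρ_0 - A_02 ρ_1) (`fderiv_G`). Cramer's rule gives G w_2 = A_02 m_0 + A_12 m_1 + A_22 m_2.
Differentiating with dm_2 = 0 expresses G dw_2 through dm_0, dm_1, the ρ_i and dG
(`structure_identity`). Since dρ_2 = ρ_1 ∧ ρ_0, wedging with it kills all terms in ρ_0, ρ_1; the
survivors are exactly those of dG ∧ e (`cyclic_identity`).

The structure equations are `fderiv_X_of_isTangent` and `r_antisymm`;
`extDeriv_pullback_smul_eq_zero` reduces closedness of the pullback to the pointwise identity. -/

namespace ChaplyginBall

/-! ### Calculus of differential forms of low degree -/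

section Forms

variable {E G : Type*} [NormedAddCommGroup E] [NormedSpace ℝ E]
  [NormedAddCommGroup G] [NormedSpace ℝ G]

/-- A field of continuous linear maps, as a differential one-form. -/
noncomputable def oneForm (T : E → E →L[ℝ] G) (p : E) : E [⋀^Fin 1]→L[ℝ] G :=
  ContinuousAlternatingMap.ofSubsingleton ℝ E G (0 : Fin 1) (T p)

theorem contDiff_oneForm {n : WithTop ℕ∞} {T : E → E →L[ℝ] G} (hT : ContDiff ℝ n T) :
    ContDiff ℝ n (oneForm T) :=
  (ContinuousAlternatingMap.ofSubsingletonLIE (𝕜 := ℝ) (E := E) (F := G)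
    (0 : Fin 1)).toContinuousLinearEquiv.contDiff.comp hT

theorem extDeriv_oneForm {T : E → E →L[ℝ] G} {p : E} (hT : DifferentiableAt ℝ T p)
    (v : Fin 2 → E) :
    extDeriv (oneForm T) p v = fderiv ℝ T p (v 0) (v 1) - fderiv ℝ T p (v 1) (v 0) := by
  have hd : DifferentiableAt ℝ (oneForm T) p :=
    ((ContinuousAlternatingMap.ofSubsingletonLIE (𝕜 := ℝ) (E := E) (F := G)
      (0 : Fin 1)).toContinuousLinearEquiv.differentiableAt).comp p hT
  have key : ∀ i : Fin 2, ∀ x : E, fderiv ℝ (fun y => oneForm T y (i.removeNth v)) p x =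
      fderiv ℝ T p x (i.removeNth v 0) := by
    intro i x
    have : (fun y => oneForm T y (i.removeNth v)) = fun y => T y (i.removeNth v 0) := rfl
    rw [this, fderiv_clm_apply hT (differentiableAt_const _)]
    simp
  rw [extDeriv_apply hd]
  simp only [key]
  simp [Fin.removeNth, sub_eq_add_neg]

theorem contDiff_extDeriv {k : ℕ} {α : E → E [⋀^Fin k]→L[ℝ] G} (hα : ContDiff ℝ ∞ α) :
    ContDiff ℝ ∞ (extDeriv α) := by
  have h : ContDiff ℝ ∞ (fderiv ℝ α) := hα.fderiv_right (m := ∞) le_rfl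
  exact (ContinuousAlternatingMap.alternatizeUncurryFinCLM ℝ E G (n := k)).contDiff.comp h

theorem extDeriv_smul_two {g : E → ℝ} {α : E → E [⋀^Fin 2]→L[ℝ] G} {p : E}
    (hg : DifferentiableAt ℝ g p) (hα : DifferentiableAt ℝ α p) (v : Fin 3 → E) :
    extDeriv (fun y => g y • α y) p v = g p • extDeriv α p v
      + (fderiv ℝ g p (v 0) • α p ![v 1, v 2] - fderiv ℝ g p (v 1) • α p ![v 0, v 2]
        + fderiv ℝ g p (v 2) • α p ![v 0, v 1]) := by
  have h0 : (0 : Fin 3).removeNth v = ![v 1, v 2] := by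
    ext1 i; fin_cases i <;> rfl
  have h1 : (1 : Fin 3).removeNth v = ![v 0, v 2] := by
    ext1 i; fin_cases i <;> rfl
  have h2 : (2 : Fin 3).removeNth v = ![v 0, v 1] := by
    ext1 i; fin_cases i <;> rfl
  rw [extDeriv, extDeriv, fderiv_fun_smul hg hα,
    ContinuousAlternatingMap.alternatizeUncurryFin_apply,
    ContinuousAlternatingMap.alternatizeUncurryFin_apply]
  simp [Fin.sum_univ_three, h0, h1, h2]
  module

theorem fderiv_fst_apply (p v : E × G) : fderiv ℝ (fun p : E × G => p.1) p v = v.1 := by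
  rw [fderiv_fst]; rfl

theorem fderiv_snd_apply (p v : E × G) : fderiv ℝ (fun p : E × G => p.2) p v = v.2 := by
  rw [fderiv_snd]; rfl

theorem fderiv_add_const_apply {g : E → G} (c : G) {p v : E} {g' : G} (h : fderiv ℝ g p v = g') :
    fderiv ℝ (fun p => g p + c) p v = g' := by
  rw [fderiv_add_const, h]

theorem fderiv_add_const_mul_apply {g h : E → ℝ} (c : ℝ) {p v : E} (hg : DifferentiableAt ℝ g p)
    (hh : DifferentiableAt ℝ h p) :
    fderiv ℝ (fun p => g p + c * h p) p v = fderiv ℝ g p v + c * fderiv ℝ h p v := by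
  rw [fderiv_fun_add hg (hh.const_mul c), fderiv_const_mul hh]
  simp

end Forms

/-! ### Calculus of bilinear expressions -/

section Bilinear

variable {V E F G : Type*} [NormedAddCommGroup V] [NormedSpace ℝ V]
  [NormedAddCommGroup E] [NormedSpace ℝ E] [FiniteDimensional ℝ E]
  [NormedAddCommGroup F] [NormedSpace ℝ F] [FiniteDimensional ℝ F]
  [NormedAddCommGroup G] [NormedSpace ℝ G]

theorem contDiff_bilin {n : WithTop ℕ∞} (B : E →ₗ[ℝ] F →ₗ[ℝ] G) {a : V → E} {b : V → F}
    (ha : ContDiff ℝ n a) (hb : ContDiff ℝ n b) : ContDiff ℝ n fun x => B (a x) (b x) :=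
  (B.toContinuousBilinearMap.contDiff.comp ha).clm_apply hb

theorem fderiv_bilin (B : E →ₗ[ℝ] F →ₗ[ℝ] G) {a : V → E} {b : V → F} {x v : V} {a' : E} {b' : F}
    (ha : DifferentiableAt ℝ a x) (hb : DifferentiableAt ℝ b x)
    (ha' : fderiv ℝ a x v = a') (hb' : fderiv ℝ b x v = b') :
    fderiv ℝ (fun x => B (a x) (b x)) x v = B a' (b x) + B (a x) b' := by
  have h := (B.toContinuousBilinearMap.hasFDerivAt_of_bilinear ha.hasFDerivAt
    hb.hasFDerivAt).fderiv
  have h' : (fun x => B (a x) (b x)) = fun x => B.toContinuousBilinearMap (a x) (b x) := rfl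
  rw [h', h]
  simp [add_comm, ha', hb']

theorem contDiff_lin {n : WithTop ℕ∞} (A : E →ₗ[ℝ] G) {a : V → E} (ha : ContDiff ℝ n a) :
    ContDiff ℝ n fun x => A (a x) :=
  (LinearMap.toContinuousLinearMap A).contDiff.comp ha

theorem fderiv_lin (A : E →ₗ[ℝ] G) {a : V → E} {x v : V} {a' : E}
    (ha : DifferentiableAt ℝ a x) (ha' : fderiv ℝ a x v = a') :
    fderiv ℝ (fun x => A (a x)) x v = A a' := by
  have h := ((LinearMap.toContinuousLinearMap A).hasFDerivAt.comp x ha.hasFDerivAt).fderiv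
  have h' : (fun x => A (a x)) = (LinearMap.toContinuousLinearMap A) ∘ a := rfl
  rw [h', h]
  simp [ha']

/-- The derivative of the determinant of a symmetric `3 × 3` matrix. -/
theorem fderiv_symm_det {a b c d e g : V → ℝ} {x v : V} {a' b' c' d' e' g' : ℝ}
    (ha : DifferentiableAt ℝ a x) (hb : DifferentiableAt ℝ b x) (hc : DifferentiableAt ℝ c x)
    (hd : DifferentiableAt ℝ d x) (he : DifferentiableAt ℝ e x) (hg : DifferentiableAt ℝ g x)
    (ha' : fderiv ℝ a x v = a') (hb' : fderiv ℝ b x v = b') (hc' : fderiv ℝ c x v = c')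
    (hd' : fderiv ℝ d x v = d') (he' : fderiv ℝ e x v = e') (hg' : fderiv ℝ g x v = g') :
    fderiv ℝ (fun x => a x * (d x * g x - e x ^ 2) - b x * (b x * g x - c x * e x)
        + c x * (b x * e x - c x * d x)) x v =
      a' * (d x * g x - e x ^ 2) + d' * (a x * g x - c x ^ 2) + g' * (a x * d x - b x ^ 2)
        + 2 * b' * (c x * e x - b x * g x) + 2 * c' * (b x * e x - c x * d x)
        + 2 * e' * (b x * c x - a x * e x) := by
  have h := (((ha.hasFDerivAt.mul ((hd.hasFDerivAt.mul hg.hasFDerivAt).sub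
    (he.hasFDerivAt.pow 2))).sub (hb.hasFDerivAt.mul ((hb.hasFDerivAt.mul hg.hasFDerivAt).sub
    (hc.hasFDerivAt.mul he.hasFDerivAt)))).add (hc.hasFDerivAt.mul
    ((hb.hasFDerivAt.mul he.hasFDerivAt).sub (hc.hasFDerivAt.mul hd.hasFDerivAt)))).fderiv
  refine (congrArg (fun T => T v) h).trans ?_
  simp [ha', hb', hc', hd', he', hg']
  ring

end Bilinear

/-! ### The moving frame -/

/-- The orthonormal basis `Z₁, Z₂, Y₃` of `𝔰𝔬(3)`. -/
noncomputable def frame : Fin 3 → so3 := ![Z 0, Z 1, Y3]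

theorem so3_entries (A : so3) :
    (A : Mat) = !![0, (A : Mat) 0 1, (A : Mat) 0 2; -(A : Mat) 0 1, 0, (A : Mat) 1 2;
      -(A : Mat) 0 2, -(A : Mat) 1 2, 0] := by
  have h' : ∀ i j, (A : Mat) j i = -(A : Mat) i j := fun i j =>
    congrFun (congrFun (mem_so3.1 A.2) i) j
  have h00 := h' 0 0
  have h11 := h' 1 1
  have h22 := h' 2 2
  have h01 := h' 0 1
  have h02 := h' 0 2
  have h12 := h' 1 2
  ext i j
  fin_cases i <;> fin_cases j <;> simp <;> linarith

theorem coe_frame_zero : (frame 0 : Mat) = !![0, 0, 1; 0, 0, 0; -1, 0, 0] := by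
  ext i j; fin_cases i <;> fin_cases j <;> simp [frame, Z, elem]

theorem coe_frame_one : (frame 1 : Mat) = !![0, 0, 0; 0, 0, 1; 0, -1, 0] := by
  ext i j; fin_cases i <;> fin_cases j <;> simp [frame, Z, elem]

theorem coe_frame_two : (frame 2 : Mat) = !![0, 1, 0; -1, 0, 0; 0, 0, 0] := by
  ext i j; fin_cases i <;> fin_cases j <;> simp [frame, Y3, elem]

theorem pairing_apply (A B : Mat) : pairing A B = -(1 / 2 : ℝ) * (A * B).trace := rfl

theorem pairing_comm (A B : Mat) : pairing A B = pairing B A := by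
  rw [pairing_apply, pairing_apply, Matrix.trace_mul_comm]

theorem pairing_frame_zero (A : so3) : pairing (frame 0) A = (A : Mat) 0 2 := by
  rw [so3_entries A, coe_frame_zero]
  simp [pairing_apply, Matrix.trace, Fin.sum_univ_three]; ring

theorem pairing_frame_one (A : so3) : pairing (frame 1) A = (A : Mat) 1 2 := by
  rw [so3_entries A, coe_frame_one]
  simp [pairing_apply, Matrix.trace, Fin.sum_univ_three]; ring

theorem pairing_frame_two (A : so3) : pairing (frame 2) A = (A : Mat) 0 1 := by
  rw [so3_entries A, coe_frame_two]
  simp [pairing_apply, Matrix.trace, Fin.sum_univ_three]; ring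

theorem pairing_frame_frame (i j : Fin 3) :
    pairing (frame i) (frame j) = if i = j then 1 else 0 := by
  fin_cases i <;> simp only [Fin.zero_eta, Fin.mk_one, Fin.reduceFinMk, pairing_frame_zero,
    pairing_frame_one, pairing_frame_two] <;> fin_cases j <;>
    simp [coe_frame_zero, coe_frame_one, coe_frame_two]

theorem frame_expansion (A : so3) :
    A = ∑ k, pairing (frame k) A • frame k := by
  ext i j
  simp only [Fin.sum_univ_three, pairing_frame_zero, pairing_frame_one, pairing_frame_two]
  rw [so3_entries A]
  fin_cases i <;> fin_cases j <;> simp [coe_frame_zero, coe_frame_one, coe_frame_two]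

/-- The structure matrix of `𝔰𝔬(3)`: `[e_i, ∑ ρ_k e_k] = ∑ (structureMatrix ρ i k) e_k`. -/
def structureMatrix (ρ : Fin 3 → ℝ) : Matrix (Fin 3) (Fin 3) ℝ :=
  !![0, ρ 2, -ρ 1; -ρ 2, 0, ρ 0; ρ 1, -ρ 0, 0]

theorem frame_commutator (i : Fin 3) (A : so3) :
    (frame i : Mat) * A - A * frame i =
      ∑ k, structureMatrix (fun l => pairing (frame l) A) i k • (frame k : Mat) := by
  simp only [Fin.sum_univ_three, structureMatrix, pairing_frame_zero, pairing_frame_one,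
    pairing_frame_two]
  rw [so3_entries A]
  ext a b
  fin_cases i <;> fin_cases a <;> fin_cases b <;>
    simp [coe_frame_zero, coe_frame_one, coe_frame_two]

theorem pairing_frame_commutator (A B : so3) (i : Fin 3) :
    pairing (frame i) ((A : Mat) * B - B * A) =
      ∑ k, pairing (frame k) A *
        structureMatrix (fun l => pairing (frame l) B) k i := by
  have hA : ((A : so3) : Mat) = ∑ k, pairing (frame k) A • (frame k : Mat) := by
    conv_lhs => rw [frame_expansion A]
    simp
  have hc : (A : Mat) * B - B * A =
      ∑ k, pairing (frame k) A • ((frame k : Mat) * B - B * frame k) := by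
    conv_lhs => rw [hA]
    simp [Finset.sum_mul, Finset.mul_sum, smul_sub]
  rw [hc]
  simp only [frame_commutator, map_sum, map_smul, pairing_frame_frame, smul_eq_mul]
  simp [mul_comm]

/-- The pairing, restricted to `𝔰𝔬(3)`. -/
noncomputable def form : so3 →ₗ[ℝ] so3 →ₗ[ℝ] ℝ := pairing.compl₁₂ so3.subtype so3.subtype

theorem form_apply (A B : so3) : form A B = pairing A B := rfl

/-- The basis `Ad(s⁻¹) e_i` of `𝔰𝔬(3)`: the space frame seen in the body frame. -/
noncomputable def X (i : Fin 3) (p : Amb) : so3 := Ad p.1ᵀ (frame i)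

theorem coe_X (i : Fin 3) (p : Amb) : (X i p : Mat) = p.1ᵀ * frame i * p.1 := by
  simp [X, Ad]

theorem mul_transpose_of_mem_TS {p : Amb} (hp : p ∈ TS) : p.1 * p.1ᵀ = 1 :=
  Matrix.mem_orthogonalGroup_iff (Fin 3) ℝ |>.1 (Matrix.mem_specialOrthogonalGroup_iff.1 hp).1

theorem transpose_mul_of_mem_TS {p : Amb} (hp : p ∈ TS) : p.1ᵀ * p.1 = 1 :=
  Matrix.mem_orthogonalGroup_iff' (Fin 3) ℝ |>.1 (Matrix.mem_specialOrthogonalGroup_iff.1 hp).1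

theorem pairing_conj (s A B : Mat) : pairing (sᵀ * A * s) B = pairing A (s * B * sᵀ) := by
  rw [pairing_apply, pairing_apply]
  congr 1
  calc (sᵀ * A * s * B).trace = (sᵀ * (A * s * B)).trace := by simp only [Matrix.mul_assoc]
    _ = _ := by rw [Matrix.trace_mul_comm]; simp only [Matrix.mul_assoc]

theorem pairing_X (i : Fin 3) (p : Amb) (A : so3) :
    pairing (X i p) A = pairing (frame i) (Ad p.1 A) := by
  rw [coe_X, pairing_conj]; rfl

theorem Ad_transpose_Ad {p : Amb} (hp : p ∈ TS) (A : so3) : Ad p.1ᵀ (Ad p.1 A) = A := by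
  have h := transpose_mul_of_mem_TS hp
  ext1
  simp only [Ad, LinearMap.coe_mk, AddHom.coe_mk, Matrix.transpose_transpose]
  calc _ = (p.1ᵀ * p.1) * (A : Mat) * (p.1ᵀ * p.1) := by simp only [Matrix.mul_assoc]
    _ = _ := by rw [h]; simp

theorem Ad_Ad_transpose {p : Amb} (hp : p ∈ TS) (A : so3) : Ad p.1 (Ad p.1ᵀ A) = A := by
  have h := mul_transpose_of_mem_TS hp
  ext1
  simp only [Ad, LinearMap.coe_mk, AddHom.coe_mk, Matrix.transpose_transpose]
  calc _ = (p.1 * p.1ᵀ) * (A : Mat) * (p.1 * p.1ᵀ) := by simp only [Matrix.mul_assoc]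
    _ = _ := by rw [h]; simp

theorem pairing_X_X {p : Amb} (hp : p ∈ TS) (i j : Fin 3) :
    pairing (X i p) (X j p) = if i = j then 1 else 0 := by
  rw [pairing_X, X, Ad_Ad_transpose hp, pairing_frame_frame]

theorem X_expansion {p : Amb} (hp : p ∈ TS) (A : so3) :
    A = ∑ k, pairing (X k p) A • X k p := by
  conv_lhs => rw [← Ad_transpose_Ad hp A, frame_expansion (Ad p.1 A)]
  simp only [map_sum, map_smul, pairing_X]; rfl

/-- The projection of matrices to their skew-symmetric part. -/
noncomputable def skewPart : Mat →ₗ[ℝ] so3 where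
  toFun A := ⟨(1 / 2 : ℝ) • (A - Aᵀ), mem_so3.2 (by simp [Matrix.transpose_sub, ← smul_neg])⟩
  map_add' A B := by ext1; simp [← smul_add]; abel
  map_smul' c A := by ext1; simp [smul_sub, smul_comm c]

theorem skewPart_coe (A : so3) : skewPart A = A := by
  ext1
  simp only [skewPart, LinearMap.coe_mk, AddHom.coe_mk, mem_so3.1 A.2]
  module

/-- Transposition, as a linear map. -/
def transposeLin : Mat →ₗ[ℝ] Mat := (Matrix.transposeLinearEquiv (Fin 3) (Fin 3) ℝ ℝ).toLinearMap

/-! ### Smoothness and derivatives of the moving frame -/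

theorem contDiff_fst_mat : ContDiff ℝ ∞ fun p : Amb => p.1 := contDiff_fst

theorem fderiv_fst_mat (p v : Amb) : fderiv ℝ (fun p : Amb => p.1) p v = v.1 :=
  fderiv_fst_apply p v

theorem differentiableAt_fst_mat (p : Amb) : DifferentiableAt ℝ (fun p : Amb => p.1) p :=
  contDiff_fst_mat.differentiable (by simp) p

theorem contDiff_transpose : ContDiff ℝ ∞ fun p : Amb => p.1ᵀ :=
  contDiff_lin transposeLin contDiff_fst_mat

theorem contDiff_mat_mul {a b : Amb → Mat} (ha : ContDiff ℝ ∞ a) (hb : ContDiff ℝ ∞ b) :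
    ContDiff ℝ ∞ fun p => a p * b p :=
  contDiff_bilin (LinearMap.mul ℝ Mat) ha hb

theorem fderiv_mat_mul {a b : Amb → Mat} {p : Amb} (ha : DifferentiableAt ℝ a p)
    (hb : DifferentiableAt ℝ b p) (v : Amb) :
    fderiv ℝ (fun p => a p * b p) p v = fderiv ℝ a p v * b p + a p * fderiv ℝ b p v :=
  fderiv_bilin (LinearMap.mul ℝ Mat) ha hb rfl rfl

theorem fderiv_transpose (p v : Amb) : fderiv ℝ (fun p : Amb => p.1ᵀ) p v = v.1ᵀ :=
  fderiv_lin transposeLin (differentiableAt_fst_mat p) (fderiv_fst_apply p v)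

theorem contDiff_coe_X (i : Fin 3) : ContDiff ℝ ∞ fun p : Amb => (X i p : Mat) := by
  simp only [coe_X]
  exact contDiff_mat_mul (contDiff_mat_mul contDiff_transpose contDiff_const) contDiff_fst_mat

theorem contDiff_X (i : Fin 3) : ContDiff ℝ ∞ (X i) := by
  -- Smoothness is known for the matrix of `X i`; the linear retraction `skewPart` carries it over
  -- to the subspace `so3`.
  have h : X i = fun p => skewPart (X i p : Mat) := by ext1 p; rw [skewPart_coe]
  rw [h]
  exact contDiff_lin skewPart (contDiff_coe_X i)

theorem differentiableAt_X (i : Fin 3) (p : Amb) : DifferentiableAt ℝ (X i) p :=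
  (contDiff_X i).differentiable (by simp) p

theorem coe_fderiv_X (i : Fin 3) (p v : Amb) :
    (fderiv ℝ (X i) p v : Mat) = v.1ᵀ * frame i * p.1 + p.1ᵀ * frame i * v.1 := by
  have h := fderiv_lin so3.subtype (v := v) (differentiableAt_X i p) rfl
  have hT : DifferentiableAt ℝ (fun p : Amb => p.1ᵀ) p :=
    contDiff_transpose.differentiable (by simp) p
  have h1 : DifferentiableAt ℝ (fun p : Amb => p.1ᵀ * (frame i : Mat)) p :=
    (contDiff_mat_mul contDiff_transpose contDiff_const).differentiable (by simp) p
  have h2 : (fun p => so3.subtype (X i p)) = fun p : Amb => p.1ᵀ * frame i * p.1 := by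
    ext1 p; exact coe_X i p
  have h3 := fderiv_mat_mul h1 (differentiableAt_fst_mat p) v
  have h4 := fderiv_mat_mul hT (differentiableAt_const (frame i : Mat)) v
  rw [h4, fderiv_transpose, fderiv_fst_mat] at h3
  rw [h2] at h
  refine (h.symm.trans h3).trans ?_
  simp

/-- The one-forms `⟨e_i, δs s⁻¹⟩`. -/
noncomputable def r (i : Fin 3) : Amb →L[ℝ] Amb →L[ℝ] ℝ :=
  LinearMap.toContinuousBilinearMap <| LinearMap.mk₂ ℝ
    (fun p ξ : Amb => pairing (frame i) (ξ.1 * p.1ᵀ))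
    (fun p p' ξ => by simp [mul_add]) (fun c p ξ => by simp)
    (fun p ξ ξ' => by simp [add_mul]) (fun c p ξ => by simp)

theorem r_apply (i : Fin 3) (p ξ : Amb) : r i p ξ = pairing (frame i) (ξ.1 * p.1ᵀ) := rfl

/-- `ξ` is tangent to `T S` at `p`. -/
def IsTangent (p ξ : Amb) : Prop := ∃ A : so3, ξ.1 = (A : Mat) * p.1

theorem r_of_eq {p ξ : Amb} (hp : p ∈ TS) {A : so3} (h : ξ.1 = (A : Mat) * p.1) (i : Fin 3) :
    r i p ξ = pairing (frame i) A := by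
  rw [r_apply, h, Matrix.mul_assoc, mul_transpose_of_mem_TS hp, mul_one]

/-- For δs = A s, differentiating sᵀ e_i s gives Ad(s⁻¹)[e_i, A], because A is skew. -/
theorem fderiv_X_of_isTangent {p ξ : Amb} (hp : p ∈ TS) (h : IsTangent p ξ) (i : Fin 3) :
    fderiv ℝ (X i) p ξ = ∑ k, structureMatrix (fun l => r l p ξ) i k • X k p := by
  obtain ⟨A, hA⟩ := h
  ext1
  have hT : ξ.1ᵀ = -(p.1ᵀ * A) := by
    rw [hA, Matrix.transpose_mul, mem_so3.1 A.2, mul_neg]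
  have hr : (fun l => r l p ξ) = fun l => pairing (frame l) A := by
    ext1 l; exact r_of_eq hp hA l
  have hc : -(p.1ᵀ * (A : Mat)) * frame i * p.1 + p.1ᵀ * frame i * ((A : Mat) * p.1) =
      p.1ᵀ * ((frame i : Mat) * A - A * frame i) * p.1 := by noncomm_ring
  rw [coe_fderiv_X, hT, hr, hA, hc, frame_commutator]
  simp [Finset.mul_sum, Finset.sum_mul, coe_X]

/-- The components in the space frame of the differentials of the one-forms `r i`. -/
theorem r_antisymm {p ξ η : Amb} (hp : p ∈ TS) (hξ : IsTangent p ξ) (hη : IsTangent p η)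
    (i : Fin 3) :
    r i ξ η - r i η ξ = ∑ k, r k p ξ * structureMatrix (fun l => r l p η) k i := by
  obtain ⟨A, hA⟩ := hξ
  obtain ⟨B, hB⟩ := hη
  have h1 : ∀ (ξ η : Amb) (A B : so3), ξ.1 = (A : Mat) * p.1 → η.1 = (B : Mat) * p.1 →
      η.1 * ξ.1ᵀ = -((B : Mat) * A) := by
    intro ξ η A B hA hB
    have hT : ξ.1ᵀ = -(p.1ᵀ * A) := by
      rw [hA, Matrix.transpose_mul, mem_so3.1 A.2, mul_neg]
    calc η.1 * ξ.1ᵀ = -((B : Mat) * (p.1 * p.1ᵀ) * A) := by rw [hT, hB]; noncomm_ring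
      _ = _ := by rw [mul_transpose_of_mem_TS hp, mul_one]
  simp only [r_of_eq hp hA, r_of_eq hp hB]
  rw [← pairing_frame_commutator, r_apply, r_apply, h1 ξ η A B hA hB, h1 η ξ B A hB hA,
    ← map_sub]
  congr 1
  abel

section SpaceFrame

/-! ### Components of the velocity, the momentum and the inertia in the space frame -/

/-- The components of the angular velocity. -/
noncomputable def w (i : Fin 3) (p : Amb) : ℝ := form (X i p) p.2

/-- The components of `𝕀 u`. -/
noncomputable def q (I : so3 →ₗ[ℝ] so3) (i : Fin 3) (p : Amb) : ℝ := form (I p.2) (X i p)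

/-- The matrix of the inertia tensor. -/
noncomputable def J (I : so3 →ₗ[ℝ] so3) (i j : Fin 3) (p : Amb) : ℝ := form (I (X i p)) (X j p)

theorem contDiff_w (i : Fin 3) : ContDiff ℝ ∞ (w i) :=
  contDiff_bilin form (contDiff_X i) contDiff_snd

theorem contDiff_q (I : so3 →ₗ[ℝ] so3) (i : Fin 3) : ContDiff ℝ ∞ (q I i) :=
  contDiff_bilin form (contDiff_lin I contDiff_snd) (contDiff_X i)

theorem contDiff_J (I : so3 →ₗ[ℝ] so3) (i j : Fin 3) : ContDiff ℝ ∞ (J I i j) :=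
  contDiff_bilin form (contDiff_lin I (contDiff_X i)) (contDiff_X j)

variable {I : so3 →ₗ[ℝ] so3} {p ξ : Amb}

/-- The sum is the rotation of the frame, the last term the variation of u. The same splitting
occurs in `fderiv_q`; in `fderiv_J` only the rotation is left, since 𝕀 does not depend on s. -/
theorem fderiv_w (hp : p ∈ TS) (hξ : IsTangent p ξ) (i : Fin 3) :
    fderiv ℝ (w i) p ξ =
      ∑ k, structureMatrix (fun l => r l p ξ) i k * w k p + form (X i p) ξ.2 := by
  refine (fderiv_bilin form (differentiableAt_X i p) differentiableAt_snd
    (fderiv_X_of_isTangent hp hξ i) (fderiv_snd_apply p ξ)).trans ?_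
  simp [w]

theorem fderiv_q (hp : p ∈ TS) (hξ : IsTangent p ξ) (i : Fin 3) :
    fderiv ℝ (q I i) p ξ =
      ∑ k, structureMatrix (fun l => r l p ξ) i k * q I k p + form (I ξ.2) (X i p) := by
  have hd : DifferentiableAt ℝ (fun p : Amb => I p.2) p :=
    (contDiff_lin (n := ∞) I contDiff_snd).differentiable (by simp) p
  refine (fderiv_bilin form hd (differentiableAt_X i p)
    (fderiv_lin I differentiableAt_snd (fderiv_snd_apply p ξ))
    (fderiv_X_of_isTangent hp hξ i)).trans ?_
  simp [q, add_comm]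

theorem fderiv_J (hp : p ∈ TS) (hξ : IsTangent p ξ) (i j : Fin 3) :
    fderiv ℝ (J I i j) p ξ =
      ∑ k, structureMatrix (fun l => r l p ξ) i k * J I k j p +
      ∑ k, structureMatrix (fun l => r l p ξ) j k * J I i k p := by
  have hd : DifferentiableAt ℝ (fun p => I (X i p)) p :=
    (contDiff_lin I (contDiff_X i)).differentiable (by simp) p
  refine (fderiv_bilin form hd (differentiableAt_X j p)
    (fderiv_lin I (differentiableAt_X i p) (fderiv_X_of_isTangent hp hξ i))
    (fderiv_X_of_isTangent hp hξ j)).trans ?_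
  simp [J]

theorem form_comm (A B : so3) : form A B = form B A := pairing_comm _ _

theorem J_symm (hI : IsInertiaTensor I) (i j : Fin 3) (p : Amb) : J I i j p = J I j i p := by
  rw [J, J, form_comm (I (X j p))]
  exact hI.symm _ _

theorem form_I_X (hI : IsInertiaTensor I) (hp : p ∈ TS) (A : so3) (i : Fin 3) :
    form (I A) (X i p) = ∑ k, J I i k p * form (X k p) A := by
  conv_lhs => rw [X_expansion hp A]
  simp only [map_sum, map_smul, LinearMap.sum_apply, LinearMap.smul_apply, smul_eq_mul]
  refine Finset.sum_congr rfl fun k _ => ?_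
  rw [J_symm hI, mul_comm]; rfl

theorem q_eq (hI : IsInertiaTensor I) (hp : p ∈ TS) (i : Fin 3) :
    q I i p = ∑ k, J I i k p * w k p := form_I_X hI hp _ i

/-- The determinant of `Φ_s`, as a polynomial. -/
noncomputable def G (I : so3 →ₗ[ℝ] so3) (p : Amb) : ℝ :=
  (Matrix.of fun i j => J I i j p + !![1, 0, 0; 0, 1, 0; 0, 0, 0] i j).det

theorem contDiff_G (I : so3 →ₗ[ℝ] so3) : ContDiff ℝ ∞ (G I) := by
  have h := contDiff_J I
  unfold G
  simp only [Matrix.det_fin_three, Matrix.of_apply]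
  fun_prop

/-- As Ad(s) `X i` = e_i, the constraint form has constant coefficients in this frame. This is the
source of the matrix diag(1,1,0) in `G`. -/
theorem conn_X (hp : p ∈ TS) (i : Fin 3) :
    conn p.1 (X i p) = fun a : Fin 2 => if i = a.castSucc then -1 else 0 := by
  ext a
  have h : conn p.1 (X i p) a = -(Ad p.1 (X i p) : Mat) a.castSucc 2 := rfl
  rw [h, X, Ad_Ad_transpose hp]
  fin_cases i <;> fin_cases a <;> simp [coe_frame_zero, coe_frame_one, coe_frame_two]

/-- The coordinates of `𝔰𝔬(3)` with respect to the moving frame. -/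
noncomputable def coords (hp : p ∈ TS) : so3 ≃ₗ[ℝ] (Fin 3 → ℝ) where
  toFun A i := form (X i p) A
  map_add' A B := by ext i; simp
  map_smul' c A := by ext i; simp
  invFun c := ∑ k, c k • X k p
  left_inv A := (X_expansion hp A).symm
  right_inv c := by
    ext i
    simp only [map_sum, map_smul, form_apply, pairing_X_X hp]
    simp

theorem coords_symm_single (hp : p ∈ TS) (j : Fin 3) :
    (coords hp).symm (Pi.single j 1) = X j p := by
  have h : (coords hp).symm (Pi.single j 1) = ∑ k, (Pi.single j 1 : Fin 3 → ℝ) k • X k p := rfl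
  rw [h]
  simp [Pi.single_apply]

theorem det_Phi (hI : IsInertiaTensor I) (hp : p ∈ TS) : LinearMap.det (Phi I p.1) = G I p := by
  rw [← LinearMap.det_toMatrix (Module.Basis.ofEquivFun (coords hp)), G]
  congr 1
  ext i j
  rw [LinearMap.toMatrix_apply, Module.Basis.ofEquivFun_repr_apply]
  have hb : Module.Basis.ofEquivFun (coords hp) j = X j p := by
    rw [Module.Basis.coe_ofEquivFun]
    convert coords_symm_single hp j
  have hc : ∀ A, coords hp A i = pairing A (X i p) := fun A => pairing_comm _ _
  rw [hb, hc, pairing_Phi, mu0, conn_X hp, conn_X hp]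
  change J I j i p + _ = J I i j p + _
  -- Column j of the matrix of Φ_s holds the coordinates of Φ_s X_j, so the indices of J arrive
  -- transposed.
  rw [J_symm hI j i]
  fin_cases i <;> fin_cases j <;> simp [dotProduct]

/-- Φ_s is positive definite: 𝕀 is, and 𝒜_s^* 𝒜_s is nonnegative. -/
theorem G_ne_zero (hI : IsInertiaTensor I) (hp : p ∈ TS) : G I p ≠ 0 := by
  rw [← det_Phi hI hp]
  intro h
  obtain ⟨A, hA, hA0⟩ := (Submodule.ne_bot_iff _).1 (LinearMap.bot_lt_ker_of_det_eq_zero h).ne'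
  have h1 := pairing_Phi I p.1 A A
  rw [LinearMap.mem_ker.1 hA] at h1
  have h2 := hI.pos A hA0
  have h3 : 0 ≤ conn p.1 A ⬝ᵥ conn p.1 A := by
    simp only [dotProduct]
    exact Finset.sum_nonneg fun i _ => mul_self_nonneg _
  have h4 : pairing ((0 : so3) : Mat) A = 0 := by simp
  rw [h4, mu0] at h1
  linarith

/-- No ρ_2 occurs because diag(1,1,0) is invariant under rotations about e_3. The coefficients are
the cofactors (1,2) and (0,2) of J + 1. -/
theorem fderiv_G (hI : IsInertiaTensor I) (hp : p ∈ TS) (hξ : IsTangent p ξ) :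
    fderiv ℝ (G I) p ξ =
      2 * (r 0 p ξ * (J I 0 1 p * J I 0 2 p - (J I 0 0 p + 1) * J I 1 2 p)
        - r 1 p ξ * (J I 0 1 p * J I 1 2 p - J I 0 2 p * (J I 1 1 p + 1))) := by
  have hJ : ∀ i j, DifferentiableAt ℝ (J I i j) p := fun i j =>
    (contDiff_J I i j).differentiable (by simp) p
  have hD := fun i j => fderiv_J (I := I) hp hξ i j
  have hJ' : ∀ i, DifferentiableAt ℝ (fun p => J I i i p + 1) p := fun i =>
    (hJ i i).add_const 1
  have hG : G I = fun p =>
      (J I 0 0 p + 1) * ((J I 1 1 p + 1) * J I 2 2 p - J I 1 2 p ^ 2)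
        - J I 0 1 p * (J I 0 1 p * J I 2 2 p - J I 0 2 p * J I 1 2 p)
        + J I 0 2 p * (J I 0 1 p * J I 1 2 p - J I 0 2 p * (J I 1 1 p + 1)) := by
    ext1 p
    simp [G, Matrix.det_fin_three, J_symm hI 1 0, J_symm hI 2 0, J_symm hI 2 1]
    ring
  rw [show G I = _ from hG]
  refine (fderiv_symm_det (hJ' 0) (hJ 0 1) (hJ 0 2) (hJ' 1) (hJ 1 2) (hJ 2 2)
    (fderiv_add_const_apply 1 (hD 0 0)) (hD 0 1) (hD 0 2) (fderiv_add_const_apply 1 (hD 1 1)) (hD 1 2) (hD 2 2)).trans ?_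
  simp only [Fin.sum_univ_three,
    structureMatrix, J_symm hI 1 0 p, J_symm hI 2 0 p, J_symm hI 2 1 p]
  simp
  ring

end SpaceFrame

/-! ### Forms with coefficients in a moving frame -/

section Forms

variable {V E Y : Type*} [NormedAddCommGroup V] [NormedSpace ℝ V]
  [NormedAddCommGroup E] [NormedSpace ℝ E] [NormedAddCommGroup Y] [NormedSpace ℝ Y]

theorem contDiff_frame_sum {a : Fin 3 → V → ℝ} (R : Fin 3 → V →L[ℝ] V →L[ℝ] ℝ)
    (ha : ∀ i, ContDiff ℝ ∞ (a i)) : ContDiff ℝ ∞ fun p => ∑ i, a i p • R i p :=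
  ContDiff.sum fun i _ => (ha i).smul (R i).contDiff

/-- Each `R i` is linear in the base point, so its exterior derivative is its antisymmetrization;
the rest is the Leibniz rule. -/
theorem extDeriv_frame_sum {a : Fin 3 → V → ℝ} (R : Fin 3 → V →L[ℝ] V →L[ℝ] ℝ) {p : V}
    (ha : ∀ i, ContDiff ℝ ∞ (a i)) (ξ η : V) :
    extDeriv (oneForm fun p => ∑ i, a i p • R i p) p ![ξ, η] =
      ∑ i, (fderiv ℝ (a i) p ξ * R i p η - fderiv ℝ (a i) p η * R i p ξ
        + a i p * (R i ξ η - R i η ξ)) := by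
  have hd := fun i => (ha i).differentiable (by simp) p
  have hR := fun i => (R i).differentiableAt (x := p)
  have hs : fderiv ℝ (fun p => ∑ i, a i p • R i p) p =
      ∑ i, fderiv ℝ (fun p => a i p • R i p) p :=
    fderiv_fun_sum fun i _ => (hd i).smul (hR i)
  rw [extDeriv_oneForm ((contDiff_frame_sum R ha).differentiable (by simp) p), hs]
  simp only [sum_apply, fderiv_fun_smul (hd _) (hR _)]
  simp [← Finset.sum_sub_distrib]
  refine Finset.sum_congr rfl fun i _ => ?_
  ring

theorem extDeriv_oneForm_clm (B : V →L[ℝ] V →L[ℝ] Y) (p : V) (v : Fin 2 → V) :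
    extDeriv (oneForm fun p => B p) p v = B (v 0) (v 1) - B (v 1) (v 0) := by
  rw [extDeriv_oneForm B.differentiableAt, ContinuousLinearMap.fderiv]

theorem extDeriv_oneForm_smulRight (B : V →L[ℝ] V →L[ℝ] ℝ) (y : Y) (p : V) (v : Fin 2 → V) :
    extDeriv (oneForm fun p => (B p).smulRight y) p v =
      (B (v 0) (v 1) - B (v 1) (v 0)) • y := by
  have h := extDeriv_oneForm_clm (((ContinuousLinearMap.smulRightL ℝ V Y).flip y).comp B) p v
  rw [sub_smul]
  exact h

/-- Real powers are differentiable away from 0, so no positivity of g is required. -/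
theorem hasFDerivAt_rpow_neg_half {g : V → ℝ} {p : V} (hg : DifferentiableAt ℝ g p)
    (h0 : g p ≠ 0) :
    HasFDerivAt (fun p => g p ^ (-(1 / 2) : ℝ))
      ((-(1 / 2) * (g p ^ (-(1 / 2) : ℝ) / g p)) • fderiv ℝ g p) p := by
  have h := (Real.hasDerivAt_rpow_const (p := -(1 / 2)) (Or.inl h0)).comp_hasFDerivAt p
    hg.hasFDerivAt
  rwa [Real.rpow_sub_one h0] at h

/-- A criterion for the closedness of the pullback of `g^(-1/2) (-dθ - w dρ₂)`, where
`θ = ∑ aᵢ ρᵢ` on the tangent vectors in question. -/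
theorem extDeriv_pullback_smul_eq_zero [FiniteDimensional ℝ V] {U : Set E} {M : Set V} {φ : E → V}
    (hU : IsOpen U) (hφ : ContDiffOn ℝ ∞ φ U) (hM : Set.MapsTo φ U M)
    {T : V → V →L[ℝ] ℝ} {a : Fin 3 → V → ℝ} {R : Fin 3 → V →L[ℝ] V →L[ℝ] ℝ} {w f g : V → ℝ}
    {Ω : V → V [⋀^Fin 2]→L[ℝ] ℝ} {tan : V → V → Prop}
    (hT : ∀ ξ, ContDiff ℝ ∞ fun p => T p ξ) (ha : ∀ i, ContDiff ℝ ∞ (a i))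
    (hw : ContDiff ℝ ∞ w) (hg : ContDiff ℝ ∞ g)
    (htan : ∀ y ∈ U, ∀ v, tan (φ y) (fderiv ℝ φ y v))
    (hTa : ∀ p ∈ M, ∀ ξ, tan p ξ → T p ξ = ∑ i, a i p * R i p ξ)
    (hf : ∀ p ∈ M, f p = g p ^ (-(1 / 2) : ℝ)) (hg0 : ∀ p ∈ M, g p ≠ 0)
    (hΩ : ∀ p v, Ω p v = -extDeriv (oneForm T) p v - w p * (R 2 (v 0) (v 1) - R 2 (v 1) (v 0)))
    {e : V → V → V → ℝ}
    (he : ∀ p ξ η, e p ξ η = ∑ i, (fderiv ℝ (a i) p ξ * R i p η - fderiv ℝ (a i) p η * R i p ξ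
        + a i p * (R i ξ η - R i η ξ)) + w p * (R 2 ξ η - R 2 η ξ))
    (hid : ∀ p ∈ M, ∀ ξ₀ ξ₁ ξ₂, tan p ξ₀ → tan p ξ₁ → tan p ξ₂ →
      fderiv ℝ g p ξ₀ * e p ξ₁ ξ₂ - fderiv ℝ g p ξ₁ * e p ξ₀ ξ₂ + fderiv ℝ g p ξ₂ * e p ξ₀ ξ₁ =
      2 * g p * (fderiv ℝ w p ξ₀ * (R 2 ξ₁ ξ₂ - R 2 ξ₂ ξ₁) - fderiv ℝ w p ξ₁ * (R 2 ξ₀ ξ₂ - R 2 ξ₂ ξ₀)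
        + fderiv ℝ w p ξ₂ * (R 2 ξ₀ ξ₁ - R 2 ξ₁ ξ₀)))
    {x : E} (hx : x ∈ U) :
    extDeriv (pullback φ fun p => f p • Ω p) x = 0 := by
  have htwo : minSmoothness ℝ 2 ≤ ∞ := by
    rw [minSmoothness_of_isRCLikeNormedField]
    exact WithTop.coe_le_coe.2 (le_top : (2 : ℕ∞) ≤ ⊤)
  have hφat : ∀ y ∈ U, ContDiffAt ℝ ∞ φ y := fun y hy => hφ.contDiffAt (hU.mem_nhds hy)
  let Θ : V → V [⋀^Fin 1]→L[ℝ] ℝ := oneForm fun p => ∑ i, a i p • R i p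
  have hΘ : ContDiff ℝ ∞ Θ := contDiff_oneForm (contDiff_frame_sum R ha)
  have hT' : ContDiff ℝ ∞ (oneForm T) := contDiff_oneForm (contDiff_clm_apply_iff.2 hT)
  have hR : ContDiff ℝ ∞ (oneForm fun p => R 2 p) := contDiff_oneForm (R 2).contDiff
  let W : V → V [⋀^Fin 2]→L[ℝ] ℝ := fun p => -extDeriv Θ p - w p • extDeriv (oneForm fun p => R 2 p) p
  have hW : ContDiff ℝ ∞ W :=
    (contDiff_extDeriv hΘ).neg.sub (hw.smul (contDiff_extDeriv hR))
  -- T and ∑ aᵢ ρᵢ agree only on tangent vectors over M, so their ambient exterior derivatives may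
  -- differ. Their pullbacks agree on the open set U, and d commutes with pullback.
  have hpull : ∀ y ∈ U, (extDeriv (oneForm T) (φ y)).compContinuousLinearMap (fderiv ℝ φ y) =
      (extDeriv Θ (φ y)).compContinuousLinearMap (fderiv ℝ φ y) := by
    intro y hy
    rw [← extDeriv_pullback (hT'.differentiable (by simp) _) (hφat y hy) htwo,
      ← extDeriv_pullback (hΘ.differentiable (by simp) _) (hφat y hy) htwo]
    refine Filter.EventuallyEq.extDeriv_eq ?_
    filter_upwards [hU.mem_nhds hy] with z hz
    ext v
    change T (φ z) (fderiv ℝ φ z (v 0)) = (∑ i, a i (φ z) • R i (φ z)) (fderiv ℝ φ z (v 0))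
    rw [hTa _ (hM hz) _ (htan z hz _)]
    simp
  let h : V → ℝ := fun p => g p ^ (-(1 / 2) : ℝ)
  -- On U the form may thus be replaced by h • W, which is differentiable on the ambient space at φ
  -- x, so that d can be taken before pulling back.
  have heq : (pullback φ fun p => f p • Ω p) =ᶠ[nhds x]
      fun y => (h (φ y) • W (φ y)).compContinuousLinearMap (fderiv ℝ φ y) := by
    filter_upwards [hU.mem_nhds hx] with y hy
    ext v
    have h1 := congrArg (fun α => α v) (hpull y hy)
    simp only [ContinuousAlternatingMap.compContinuousLinearMap_apply] at h1
    simp only [pullback, ContinuousAlternatingMap.compContinuousLinearMap_apply,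
      ContinuousAlternatingMap.smul_apply, hΩ, h1, hf _ (hM hy), W, h,
      ContinuousAlternatingMap.sub_apply, ContinuousAlternatingMap.neg_apply,
      extDeriv_oneForm_clm (R 2), smul_eq_mul]
  have hpM := hM hx
  have hgd : DifferentiableAt ℝ g (φ x) := hg.differentiable (by simp) _
  have hh := hasFDerivAt_rpow_neg_half hgd (hg0 _ hpM)
  have hWd : DifferentiableAt ℝ W (φ x) := hW.differentiable (by simp) _
  have hhW : DifferentiableAt ℝ (fun p => h p • W p) (φ x) := hh.differentiableAt.smul hWd
  rw [heq.extDeriv_eq, extDeriv_pullback hhW (hφat x hx) htwo]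
  ext v
  rw [ContinuousAlternatingMap.compContinuousLinearMap_apply,
    extDeriv_smul_two hh.differentiableAt hWd, hh.fderiv]
  set p := φ x with hp
  obtain ⟨ξ, hξ⟩ : ∃ ξ, ξ = ⇑(fderiv ℝ φ x) ∘ v := ⟨_, rfl⟩
  have htξ : ∀ i, tan p (ξ i) := fun i => by rw [hξ]; exact htan x hx (v i)
  rw [← hξ]
  have hWe : ∀ ξ η : V, W p ![ξ, η] = -e p ξ η := by
    intro ξ η
    have : W p ![ξ, η] = -extDeriv Θ p ![ξ, η] -
      w p * extDeriv (oneForm fun p => R 2 p) p ![ξ, η] := rfl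
    rw [this, extDeriv_frame_sum R ha, extDeriv_oneForm_clm (R 2), he]
    simp
    ring
  -- By d² = 0 only -dw ∧ dρ₂ remains.
  have hdW : extDeriv W p ξ = -(fderiv ℝ w p (ξ 0) * (R 2 (ξ 1) (ξ 2) - R 2 (ξ 2) (ξ 1))
      - fderiv ℝ w p (ξ 1) * (R 2 (ξ 0) (ξ 2) - R 2 (ξ 2) (ξ 0))
      + fderiv ℝ w p (ξ 2) * (R 2 (ξ 0) (ξ 1) - R 2 (ξ 1) (ξ 0))) := by
    have d1 : DifferentiableAt ℝ (extDeriv Θ) p :=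
      (contDiff_extDeriv hΘ).differentiable (by simp) p
    have d2 : DifferentiableAt ℝ (extDeriv (oneForm fun p => R 2 p)) p :=
      (contDiff_extDeriv hR).differentiable (by simp) p
    have dw : DifferentiableAt ℝ w p := hw.differentiable (by simp) p
    have hsum : extDeriv W p = extDeriv ((-1 : ℝ) • extDeriv Θ) p +
        extDeriv (fun p => (-w) p • extDeriv (oneForm fun p => R 2 p) p) p := by
      refine Eq.trans ?_ (extDeriv_add (d1.const_smul (-1 : ℝ)) (dw.neg.smul d2))
      congr 1
      ext1 p
      simp [W, sub_eq_add_neg]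
    rw [hsum, extDeriv_smul, extDeriv_extDeriv hΘ htwo, ContinuousAlternatingMap.add_apply,
      extDeriv_smul_two dw.neg d2, extDeriv_extDeriv hR htwo]
    simp [extDeriv_oneForm_clm (R 2), fderiv_neg]
    ring
  rw [hdW, hWe, hWe, hWe]
  have key := hid p hpM (ξ 0) (ξ 1) (ξ 2) (htξ 0) (htξ 1) (htξ 2)
  have hgp := hg0 p hpM
  change _ = (0 : ℝ)
  simp only [smul_eq_mul, FunLike.coe_smul, Pi.smul_apply]
  field_simp
  linear_combination (g p ^ (-(1 / 2) : ℝ)) * key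

end Forms

section TruncatedForm

/-! ### The truncated form in the space frame -/

variable {I : so3 →ₗ[ℝ] so3} {p ξ : Amb}

/-- The components of `Φ_s u` in the space frame. -/
noncomputable def momentum (I : so3 →ₗ[ℝ] so3) (i : Fin 3) (p : Amb) : ℝ :=
  q I i p + (if i = 2 then 0 else 1) * w i p

theorem contDiff_momentum (I : so3 →ₗ[ℝ] so3) (i : Fin 3) : ContDiff ℝ ∞ (momentum I i) :=
  (contDiff_q I i).add (contDiff_const.mul (contDiff_w i))

theorem fderiv_momentum (i : Fin 3) : fderiv ℝ (momentum I i) p ξ =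
    fderiv ℝ (q I i) p ξ + (if i = 2 then 0 else 1) * fderiv ℝ (w i) p ξ :=
  fderiv_add_const_mul_apply _ ((contDiff_q I i).differentiable (by simp) p)
    ((contDiff_w i).differentiable (by simp) p)

theorem Y3_eq : Y3 = frame 2 := rfl

theorem dOmega_apply (p : Amb) (v : Fin 2 → Amb) :
    dOmega p v = (r 2 (v 0) (v 1) - r 2 (v 1) (v 0)) • (Y3 : Mat) :=
  extDeriv_oneForm_smulRight (r 2) (Y3 : Mat) p v

/-- Both values of ω are multiples of Y_3, hence commute. -/
theorem halfBracket_omega (p : Amb) (v : Fin 2 → Amb) : halfBracket (omega p) v = 0 := by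
  have h : ∀ ξ : Amb, omega p ![ξ] = r 2 p ξ • (Y3 : Mat) := fun ξ => rfl
  change omega p ![v 0] * omega p ![v 1] - omega p ![v 1] * omega p ![v 0] = 0
  rw [h, h]
  simp [smul_smul, mul_comm]

theorem pairing_L_curv (p : Amb) (v : Fin 2 → Amb) :
    pairing (L p) (curv p v) = w 2 p * (r 2 (v 0) (v 1) - r 2 (v 1) (v 0)) := by
  have h : curv p v = (r 2 (v 0) (v 1) - r 2 (v 1) (v 0)) • (Y3 : Mat) := by
    have h' : curv p v = dOmega p v - halfBracket (omega p) v := rfl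
    rw [h', dOmega_apply, halfBracket_omega, sub_zero]
  have hw : pairing Y3 (Ad p.1 p.2) = w 2 p := (pairing_X 2 p p.2).symm
  have h1 : pairing (Y3 : Mat) Y3 = 1 := by rw [Y3_eq, pairing_frame_frame]; rfl
  rw [h, L, hw, map_smul, map_smul, LinearMap.smul_apply, h1]
  simp [mul_comm]

/-- The canonical one-form, as a field of continuous linear maps. -/
noncomputable def thetaLin (I : so3 →ₗ[ℝ] so3) (p : Amb) : Amb →L[ℝ] ℝ :=
  LinearMap.toContinuousLinearMap <|
    pairing (Phi I p.1 p.2) ∘ₗ LinearMap.mulLeft ℝ (p.1ᵀ) ∘ₗ LinearMap.fst ℝ Mat so3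

theorem thetaLin_apply (p ξ : Amb) :
    thetaLin I p ξ = pairing (Phi I p.1 p.2) (p.1ᵀ * ξ.1) := rfl

theorem OmegaTilde_apply (p : Amb) (v : Fin 2 → Amb) :
    OmegaTilde I p v = -extDeriv (oneForm (thetaLin I)) p v
      - w 2 p * (r 2 (v 0) (v 1) - r 2 (v 1) (v 0)) := by
  rw [← pairing_L_curv]
  rfl

theorem conn_apply (p : Amb) (a : Fin 2) : conn p.1 p.2 a = -w a.castSucc p := by
  have h : conn p.1 p.2 a = -(Ad p.1 p.2 : Mat) a.castSucc 2 := rfl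
  rw [h, w, form_apply, pairing_X]
  fin_cases a
  · exact congrArg Neg.neg (pairing_frame_zero _).symm
  · exact congrArg Neg.neg (pairing_frame_one _).symm

theorem mu0_X (hp : p ∈ TS) (i : Fin 3) : mu0 I p.1 p.2 (X i p) = momentum I i p := by
  rw [mu0, conn_X hp, momentum]
  change q I i p + _ = _
  simp only [dotProduct, conn_apply, Fin.sum_univ_two]
  fin_cases i <;> simp

theorem thetaLin_of_isTangent (hp : p ∈ TS) (hξ : IsTangent p ξ) :
    thetaLin I p ξ = ∑ i, momentum I i p * r i p ξ := by
  obtain ⟨A, hA⟩ := hξ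
  have h1 : p.1ᵀ * ξ.1 = (Ad p.1ᵀ A : so3) := by
    rw [hA]; simp [Ad, Matrix.mul_assoc]
  have h2 : Ad p.1ᵀ A = ∑ k, r k p ξ • X k p := by
    conv_lhs => rw [frame_expansion A]
    simp only [map_sum, map_smul, r_of_eq hp hA]
    rfl
  rw [thetaLin_apply, h1, h2, ← form_apply, map_sum]
  refine Finset.sum_congr rfl fun k _ => ?_
  rw [map_smul, form_apply, pairing_Phi, mu0_X hp, smul_eq_mul, mul_comm]

theorem contDiff_thetaLin (I : so3 →ₗ[ℝ] so3) (ξ : Amb) :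
    ContDiff ℝ ∞ fun p => thetaLin I p ξ := by
  have hT : ContDiff ℝ ∞ fun p : Amb => p.1ᵀ * ξ.1 :=
    contDiff_mat_mul contDiff_transpose contDiff_const
  have hPhi : (fun p : Amb => (Phi I p.1 p.2 : Mat)) = fun p : Amb => (I p.2 : Mat)
      + (w 0 p • (X 0 p : Mat) + w 1 p • (X 1 p : Mat)) := by
    ext1 p
    have h : (Phi I p.1 p.2 : Mat) = (I p.2 : Mat) +
      (-∑ a, conn p.1 p.2 a • Ad p.1ᵀ (Z a) : so3) := rfl
    rw [h]
    simp only [conn_apply, Fin.sum_univ_two]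
    simp [X, frame]
    abel
  have h0 : ContDiff ℝ ∞ fun p : Amb => (Phi I p.1 p.2 : Mat) := by
    rw [hPhi]
    exact (contDiff_lin (so3.subtype ∘ₗ I) contDiff_snd).add
      (((contDiff_w 0).smul (contDiff_coe_X 0)).add ((contDiff_w 1).smul (contDiff_coe_X 1)))
  exact contDiff_bilin pairing h0 hT

/-- 𝒜_s annihilates Ad(s⁻¹)Y_3, so μ₀ pairs u with this direction through 𝕀 alone. -/
theorem q_two_of_mem_levelSet {lam : Module.Dual ℝ hLie} (hp : p ∈ levelSet I lam) :
    q I 2 p = lam ⟨Y3, by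
      change (Y3 : Mat) *ᵥ Pi.single 2 1 = 0
      rw [Y3_eq, coe_frame_two]
      ext i; fin_cases i <;> simp⟩ := by
  rw [← hp.2]
  have h := mu0_X (I := I) hp.1 2
  simp only [momentum, if_true, zero_mul, add_zero] at h
  exact h.symm

/-! ### The algebraic identity -/

/-- The derivative of Cramer's rule G w_2 = A_02 m_0 + A_12 m_1 + A_22 m_2. The long brackets are
dA_02 and dA_12, as cofactors turn with the frame like J does; dA_22 = -dG merges q_2 with w_2 in
the last term. -/
theorem structure_identity {J00 J01 J02 J11 J12 J22 w0 w1 w2 q0 q1 q2 ρ0 ρ1 ρ2 z0 z1 z2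
    dw0 dw1 dw2 dq0 dq1 dG : ℝ}
    (hq0 : q0 = J00 * w0 + J01 * w1 + J02 * w2) (hq1 : q1 = J01 * w0 + J11 * w1 + J12 * w2)
    (hq2 : q2 = J02 * w0 + J12 * w1 + J22 * w2)
    (hdw0 : dw0 = ρ2 * w1 - ρ1 * w2 + z0) (hdw1 : dw1 = -ρ2 * w0 + ρ0 * w2 + z1)
    (hdw2 : dw2 = ρ1 * w0 - ρ0 * w1 + z2)
    (hdq0 : dq0 = ρ2 * q1 - ρ1 * q2 + (J00 * z0 + J01 * z1 + J02 * z2))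
    (hdq1 : dq1 = -ρ2 * q0 + ρ0 * q2 + (J01 * z0 + J11 * z1 + J12 * z2))
    (hdq2 : 0 = ρ1 * q0 - ρ0 * q1 + (J02 * z0 + J12 * z1 + J22 * z2))
    (hdG : dG = 2 * (ρ0 * (J01 * J02 - (J00 + 1) * J12) - ρ1 * (J01 * J12 - J02 * (J11 + 1)))) :
    ((J00 + 1) * ((J11 + 1) * J22 - J12 ^ 2) - J01 * (J01 * J22 - J02 * J12)
        + J02 * (J01 * J12 - J02 * (J11 + 1))) * dw2 =
      (J01 * J12 - J02 * (J11 + 1)) * (dq0 + dw0) + (J01 * J02 - (J00 + 1) * J12) * (dq1 + dw1)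
      + (ρ2 * (J01 * J02 - (J00 + 1) * J12) - ρ1 * ((J00 + 1) * (J11 + 1) - J01 ^ 2)
          + ρ1 * ((J11 + 1) * (J22 + 1) - J12 ^ 2)
          - ρ0 * (J02 * J12 - J01 * (J22 + 1))) * (q0 + w0)
      + (-ρ2 * (J01 * J12 - J02 * (J11 + 1)) + ρ0 * ((J00 + 1) * (J11 + 1) - J01 ^ 2)
          + ρ1 * (J02 * J12 - J01 * (J22 + 1))
          - ρ0 * ((J00 + 1) * (J22 + 1) - J02 ^ 2)) * (q1 + w1) - dG * (q2 + w2) := by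
  subst hdG hdw0 hdw1 hdw2 hdq0 hdq1 hq0 hq1 hq2
  -- The factor is -A_22, the cofactor belonging to dm_2, which vanishes on the level set.
  linear_combination (J01 ^ 2 - (J00 + 1) * (J11 + 1)) * hdq2

end TruncatedForm

/-! ### The three-form identity on the level sets -/

section Identity

/-- The vanishing of the three-form `dG ∧ e - 2 G dw ∧ dρ₂` on three vectors, given the structure
equations and the linear relation between `dw`, `dG` and the differentials `y₀, y₁` of the
momentum. -/
theorem cyclic_identity {V : Type*} {P : V → Prop} {ρ0 ρ1 ρ2 y0 y1 dw dG : V → ℝ}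
    {d e : V → V → ℝ} {g c0 c1 A00 A01 A11 A22 n0 n1 n2 : ℝ}
    (hd : ∀ x y, P x → P y → d x y = ρ1 x * ρ0 y - ρ0 x * ρ1 y)
    (hG : ∀ x, P x → dG x = 2 * (ρ0 x * c1 - ρ1 x * c0))
    (hw : ∀ x, P x → g * dw x = c0 * y0 x + c1 * y1 x
      + (ρ2 x * c1 - ρ1 x * A22 + ρ1 x * A00 - ρ0 x * A01) * n0
      + (-ρ2 x * c0 + ρ0 x * A22 + ρ1 x * A01 - ρ0 x * A11) * n1 - dG x * n2)
    (he : ∀ x y, P x → P y → e x y = y0 x * ρ0 y - y0 y * ρ0 x + (y1 x * ρ1 y - y1 y * ρ1 x)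
      + n0 * (ρ2 x * ρ1 y - ρ1 x * ρ2 y) + n1 * (ρ0 x * ρ2 y - ρ2 x * ρ0 y) + n2 * d x y)
    {a b c : V} (ha : P a) (hb : P b) (hc : P c) :
    dG a * e b c - dG b * e a c + dG c * e a b =
      2 * g * (dw a * d b c - dw b * d a c + dw c * d a b) := by
  -- Only the product g · dw is known, so g is moved next to each dw.
  have h1 : 2 * g * (dw a * d b c - dw b * d a c + dw c * d a b) =
      2 * ((g * dw a) * d b c - (g * dw b) * d a c + (g * dw c) * d a b) := by ring
  rw [h1, hw a ha, hw b hb, hw c hc, he b c hb hc, he a c ha hc, he a b ha hb, hd b c hb hc,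
    hd a c ha hc, hd a b ha hb, hG a ha, hG b hb, hG c hc]
  ring

variable {I : so3 →ₗ[ℝ] so3} {p ξ : Amb}

theorem G_eq (hI : IsInertiaTensor I) (p : Amb) : G I p =
      (J I 0 0 p + 1) * ((J I 1 1 p + 1) * J I 2 2 p - J I 1 2 p ^ 2)
        - J I 0 1 p * (J I 0 1 p * J I 2 2 p - J I 0 2 p * J I 1 2 p)
        + J I 0 2 p * (J I 0 1 p * J I 1 2 p - J I 0 2 p * (J I 1 1 p + 1)) := by
  simp [G, Matrix.det_fin_three, J_symm hI 1 0, J_symm hI 2 0, J_symm hI 2 1]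
  ring

/-- `ξ` is tangent to the level sets of the momentum map. -/
def IsLevelTangent (I : so3 →ₗ[ℝ] so3) (p ξ : Amb) : Prop :=
  IsTangent p ξ ∧ fderiv ℝ (q I 2) p ξ = 0

theorem fderiv_fderiv_eq_zero {E V F : Type*} [NormedAddCommGroup E] [NormedSpace ℝ E]
    [NormedAddCommGroup V] [NormedSpace ℝ V] [NormedAddCommGroup F] [NormedSpace ℝ F]
    {U : Set E} {M : Set V} {φ : E → V} {g : V → F} {c : F} {y : E} (hU : IsOpen U)
    (hd : DifferentiableAt ℝ φ y) (hM : Set.MapsTo φ U M) (hy : y ∈ U)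
    (hg : DifferentiableAt ℝ g (φ y)) (hc : ∀ p ∈ M, g p = c) (v : E) :
    fderiv ℝ g (φ y) (fderiv ℝ φ y v) = 0 := by
  have h1 : (g ∘ φ) =ᶠ[nhds y] fun _ => c := by
    filter_upwards [hU.mem_nhds hy] with z hz using hc _ (hM hz)
  have h2 := h1.fderiv_eq (𝕜 := ℝ)
  rw [fderiv_comp y hg hd] at h2
  simpa using congrArg (fun T => T v) h2

theorem isLevelTangent_fderiv {E : Type*} [NormedAddCommGroup E] [NormedSpace ℝ E] {U : Set E}
    {φ : E → Amb} {lam : Module.Dual ℝ hLie} (hU : IsOpen U) (hφ : ContDiffOn ℝ ∞ φ U)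
    (hM : Set.MapsTo φ U (levelSet I lam)) {y : E} (hy : y ∈ U) (v : E) :
    IsLevelTangent I (φ y) (fderiv ℝ φ y v) := by
  have hd : DifferentiableAt ℝ φ y :=
    (hφ.contDiffAt (hU.mem_nhds hy)).differentiableAt (by simp)
  refine ⟨?_, fderiv_fderiv_eq_zero hU hd hM hy ((contDiff_q I 2).differentiable (by simp) _)
    (fun p hp => q_two_of_mem_levelSet hp) v⟩
  set p := φ y with hp
  set ξ := fderiv ℝ φ y v with hξ
  have hpT : p ∈ TS := (hM hy).1
  have hm : DifferentiableAt ℝ (fun p : Amb => p.1 * p.1ᵀ) p :=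
    (contDiff_mat_mul contDiff_fst_mat contDiff_transpose).differentiable (by simp) p
  have h0 := fderiv_fderiv_eq_zero hU hd hM hy hm (fun p hp => mul_transpose_of_mem_TS hp.1) v
  -- Differentiating s sᵀ = 1 shows that δs sᵀ is skew; it is the required element of 𝔰𝔬(3).
  have h1 := fderiv_mat_mul (differentiableAt_fst_mat p)
    (contDiff_transpose.differentiable (by simp) p) ξ
  rw [fderiv_fst_mat, fderiv_transpose] at h1
  have h2 : ξ.1 * p.1ᵀ + p.1 * ξ.1ᵀ = 0 := h1.symm.trans h0
  refine ⟨⟨ξ.1 * p.1ᵀ, mem_so3.2 ?_⟩, ?_⟩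
  · rw [Matrix.transpose_mul, Matrix.transpose_transpose]
    exact eq_neg_of_add_eq_zero_right h2
  · change ξ.1 = ξ.1 * p.1ᵀ * p.1
    rw [Matrix.mul_assoc, transpose_mul_of_mem_TS hpT, mul_one]

theorem G_mul_fderiv_w (hI : IsInertiaTensor I) (hp : p ∈ TS) (hξ : IsLevelTangent I p ξ) :
    G I p * fderiv ℝ (w 2) p ξ =
      (J I 0 1 p * J I 1 2 p - J I 0 2 p * (J I 1 1 p + 1)) * fderiv ℝ (momentum I 0) p ξ
      + (J I 0 1 p * J I 0 2 p - (J I 0 0 p + 1) * J I 1 2 p) * fderiv ℝ (momentum I 1) p ξ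
      + (r 2 p ξ * (J I 0 1 p * J I 0 2 p - (J I 0 0 p + 1) * J I 1 2 p)
          - r 1 p ξ * ((J I 0 0 p + 1) * (J I 1 1 p + 1) - J I 0 1 p ^ 2)
          + r 1 p ξ * ((J I 1 1 p + 1) * (J I 2 2 p + 1) - J I 1 2 p ^ 2)
          - r 0 p ξ * (J I 0 2 p * J I 1 2 p - J I 0 1 p * (J I 2 2 p + 1))) * (q I 0 p + w 0 p)
      + (-r 2 p ξ * (J I 0 1 p * J I 1 2 p - J I 0 2 p * (J I 1 1 p + 1))
          + r 0 p ξ * ((J I 0 0 p + 1) * (J I 1 1 p + 1) - J I 0 1 p ^ 2)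
          + r 1 p ξ * (J I 0 2 p * J I 1 2 p - J I 0 1 p * (J I 2 2 p + 1))
          - r 0 p ξ * ((J I 0 0 p + 1) * (J I 2 2 p + 1) - J I 0 2 p ^ 2)) * (q I 1 p + w 1 p)
      - fderiv ℝ (G I) p ξ * (q I 2 p + w 2 p) := by
  have hq : ∀ i, q I i p = J I i 0 p * w 0 p + J I i 1 p * w 1 p + J I i 2 p * w 2 p := fun i => by
    rw [q_eq hI hp, Fin.sum_univ_three]
  have hdq := fun i => fderiv_q (I := I) hp hξ.1 i
  simp only [form_I_X hI hp, Fin.sum_univ_three, structureMatrix] at hdq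
  have hdw := fun i => fderiv_w hp hξ.1 i
  simp only [Fin.sum_univ_three, structureMatrix] at hdw
  have h2 := hdq 2
  rw [hξ.2] at h2
  have hs10 := J_symm hI 1 0 p
  have hs20 := J_symm hI 2 0 p
  have hs21 := J_symm hI 2 1 p
  have hm : ∀ i, i ≠ 2 → fderiv ℝ (momentum I i) p ξ =
      fderiv ℝ (q I i) p ξ + fderiv ℝ (w i) p ξ := fun i hi => by
    rw [fderiv_momentum, if_neg hi, one_mul]
  rw [G_eq hI, hm 0 (by decide), hm 1 (by decide)]
  refine structure_identity (z0 := form (X 0 p) ξ.2) (z1 := form (X 1 p) ξ.2)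
    (z2 := form (X 2 p) ξ.2) (hq 0) ((hq 1).trans ?_) ((hq 2).trans ?_)
    ((hdw 0).trans ?_) ((hdw 1).trans ?_) ((hdw 2).trans ?_)
    ((hdq 0).trans ?_) ((hdq 1).trans ?_) (h2.trans ?_) (fderiv_G hI hp hξ.1)
  all_goals simp [hs10, hs20, hs21]
  all_goals ring

/-- The exterior derivative of the canonical one-form, corrected by the curvature term. -/
noncomputable def reducedForm (I : so3 →ₗ[ℝ] so3) (p ξ η : Amb) : ℝ :=
  ∑ i, (fderiv ℝ (momentum I i) p ξ * r i p η - fderiv ℝ (momentum I i) p η * r i p ξ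
    + momentum I i p * (r i ξ η - r i η ξ)) + w 2 p * (r 2 ξ η - r 2 η ξ)

/-- Here dm_2 = 0 removes the third differential, and w_2 dρ_2 raises the coefficient of dρ_2 from
q_2 to n_2 = q_2 + w_2. -/
theorem reducedForm_eq (hp : p ∈ TS) {η : Amb} (hξ : IsLevelTangent I p ξ)
    (hη : IsLevelTangent I p η) :
    reducedForm I p ξ η =
      fderiv ℝ (momentum I 0) p ξ * r 0 p η - fderiv ℝ (momentum I 0) p η * r 0 p ξ
      + (fderiv ℝ (momentum I 1) p ξ * r 1 p η - fderiv ℝ (momentum I 1) p η * r 1 p ξ)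
      + (q I 0 p + w 0 p) * (r 2 p ξ * r 1 p η - r 1 p ξ * r 2 p η)
      + (q I 1 p + w 1 p) * (r 0 p ξ * r 2 p η - r 2 p ξ * r 0 p η)
      + (q I 2 p + w 2 p) * (r 2 ξ η - r 2 η ξ) := by
  have h2 : ∀ η, IsLevelTangent I p η → fderiv ℝ (momentum I 2) p η = 0 := fun η hη => by
    rw [fderiv_momentum, if_pos rfl, zero_mul, add_zero, hη.2]
  have m0 : momentum I 0 p = q I 0 p + w 0 p := by simp [momentum]
  have m1 : momentum I 1 p = q I 1 p + w 1 p := by simp [momentum]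
  have m2 : momentum I 2 p = q I 2 p := by simp [momentum]
  have hr := fun i => r_antisymm hp hξ.1 hη.1 i
  have r0 : r 0 ξ η - r 0 η ξ = r 2 p ξ * r 1 p η - r 1 p ξ * r 2 p η := by
    rw [hr 0]; simp [Fin.sum_univ_three, structureMatrix]; ring
  have r1 : r 1 ξ η - r 1 η ξ = r 0 p ξ * r 2 p η - r 2 p ξ * r 0 p η := by
    rw [hr 1]; simp [Fin.sum_univ_three, structureMatrix]; ring
  rw [reducedForm, Fin.sum_univ_three, h2 ξ hξ, h2 η hη, m0, m1, m2, r0, r1]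
  ring

end Identity

end ChaplyginBall

theorem proposition4p4 (I : ChaplyginBall.so3 →ₗ[ℝ] ChaplyginBall.so3)
    (hI : ChaplyginBall.IsInertiaTensor I) (lam : Module.Dual ℝ ChaplyginBall.hLie) :
    ChaplyginBall.IsClosedOn (ChaplyginBall.levelSet I lam)
      (fun p : ChaplyginBall.Amb => ChaplyginBall.f I p.1 • ChaplyginBall.OmegaTilde I p) := by
  open ChaplyginBall in
  intro m U φ hU hφ hM x hx
  refine extDeriv_pullback_smul_eq_zero hU hφ hM (T := thetaLin I) (a := momentum I) (R := r)
    (w := w 2) (g := G I) (tan := IsLevelTangent I) (e := reducedForm I) (f := fun p => f I p.1)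
    (Ω := OmegaTilde I)
    (contDiff_thetaLin I) (contDiff_momentum I) (contDiff_w 2) (contDiff_G I)
    (fun y hy v => isLevelTangent_fderiv hU hφ hM hy v)
    (fun p hp ξ hξ => thetaLin_of_isTangent hp.1 hξ.1)
    (fun p hp => congrArg (fun t : ℝ => t ^ (-(1 / 2) : ℝ)) (det_Phi hI hp.1))
    (fun p hp => G_ne_zero hI hp.1) OmegaTilde_apply (fun p ξ η => rfl) ?_ hx
  intro p hp ξ₀ ξ₁ ξ₂ h₀ h₁ h₂
  refine cyclic_identity (P := IsLevelTangent I p) (d := fun ξ η => r 2 ξ η - r 2 η ξ)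
    (e := reducedForm I p) (dG := fun ξ => fderiv ℝ (G I) p ξ) (dw := fun ξ => fderiv ℝ (w 2) p ξ)
    (fun ξ η hξ hη => ?_) (fun ξ hξ => fderiv_G hI hp.1 hξ.1)
    (fun ξ hξ => G_mul_fderiv_w hI hp.1 hξ)
    (fun ξ η hξ hη => reducedForm_eq hp.1 hξ hη) h₀ h₁ h₂
  -- The structure equation dρ_2 = ρ_1 ∧ ρ_0.
  rw [r_antisymm hp.1 hξ.1 hη.1 2]
  simp [Fin.sum_univ_three, structureMatrix]
  ring
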